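/- Let $\mathbb{K}$ be an algebraically closed field of characteristic $3$, and let $n \geq 1$ and $d \geq 3$ be integers. Let $V_{n,d} = \nu_d(\mathbb{P}^n) \subset \mathbb{P}^N$, $N = \binom{n+d}{n}-1$, be the $d$th Veronese variety, with homogeneous coordinates $z_I$ on $\mathbb{P}^N$ indexed by the exponents $I \in \mathbb{Z}_{\geq 0}^{n+1}$ with $|I| = d$, and let $I(V_{n,d}) \subset \mathbb{K}[z_I]$ be its homogeneous ideal. For $k \geq 0$ identify $H^0(\mathbb{P}^n,\mathcal{O}(k))$ with the space of forms of degree $k$ in $x_0,\dots,x_n$ (together with $0$), and let $\varphi$ be the $\mathbb{K}$-linear isomorphism from the forms of degree $d$ in $x_0,\dots,x_n$ onto the linear forms in the $z_I$ with $\varphi(x^I) = z_I$. For $s,t \in H^0(\mathbb{P}^n,\mathcal{O}(1))$ and $h \in H^0(\mathbb{P}^n,\mathcal{O}(d-2))$ put $$Q(s,t,h) = \varphi(s^2h)\,\varphi(t^2h) - \varphi(sth)^2 .$$ Let $\{s_1,\dots,s_p\}$ and $\{h_1,\dots,h_q\}$ be any bases of $H^0(\mathbb{P}^n,\mathcal{O}(1))$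 and $H^0(\mathbb{P}^n,\mathcal{O}(d-2))$ respectively (for instance the coordinates $x_0,\dots,x_n$ and the monomials of degree $d-2$), and let $H = \{h_1,\dots,h_q\} \cup \{h_i+h_j \mid 1 \le i<j \le q\}$. Let $\Gamma(\mathcal{O}(1),\mathcal{O}(d-2))$ be the set of all the following elements, where $h$ runs through $H$ and the indices run through $\{1,\dots,p\}$: * $Q(s_i,s_j,h)$ with $i<j$; * $Q(s_i+s_j,s_k,h)$ with $i<j$ and $k \neq i,j$; * $Q(s_i+s_j,s_k+s_l,h)$ with $i<j$, $k<l$, $i<k$ and $j \neq k,l$. Then $\Gamma(\mathcal{O}(1),\mathcal{O}(d-2))$ is a finite set of quadratic forms of rank $3$, and it generates the ideal $I(V_{n,d})$. -/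

import Mathlib

open MvPolynomial LinearAlgebra.Projectivization

noncomputable section

namespace Veronese

/-- The index set `A(n,d)` of exponents `I = (a_0, …, a_n)` with `a_0 + ⋯ + a_n = d`. -/
abbrev Idx (n d : ℕ) : Type := {I : Fin (n + 1) →₀ ℕ // ∑ i, I i = d}

instance instFintypeIdx (n d : ℕ) : Fintype (Idx n d) :=
  Fintype.subtype (Finset.finsuppAntidiag Finset.univ d) (by simp)

section Geometry

variable {K : Type*} [Field K]

/-- The monomial `x^I` evaluated at `x`, for all `I ∈ A(n,d)`. -/
def monomialVector (n d : ℕ) (x : Fin (n + 1) → K) : Idx n d → K :=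
  fun I => ∏ i, x i ^ I.1 i

theorem monomialVector_ne_zero (n d : ℕ) {x : Fin (n + 1) → K} (hx : x ≠ 0) :
    monomialVector n d x ≠ 0 := by
  obtain ⟨i, hi⟩ := Function.ne_iff.mp hx
  intro h
  have h1 := congrFun h ⟨Finsupp.single i d, by simp [Finsupp.single_apply]⟩
  simp only [monomialVector, Pi.zero_apply] at h1
  obtain ⟨j, -, hj⟩ := Finset.prod_eq_zero_iff.mp h1
  by_cases hij : i = j
  · subst hij
    exact hi (eq_zero_of_pow_eq_zero hj)
  · simp [hij] at hj

theorem monomialVector_smul (n d : ℕ) (t : K) (x : Fin (n + 1) → K) :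
    monomialVector n d (t • x) = t ^ d • monomialVector n d x := by
  funext I
  simp only [monomialVector, Pi.smul_apply, smul_eq_mul, mul_pow, Finset.prod_mul_distrib]
  rw [Finset.prod_pow_eq_pow_sum, I.2]

/-- The `d`-th Veronese embedding `ν_d : ℙⁿ → ℙᴺ`, where the homogeneous coordinates of `ℙᴺ` are
indexed by `A(n,d)`. -/
def veroneseMap (K : Type*) [Field K] (n d : ℕ) :
    ℙ K (Fin (n + 1) → K) → ℙ K (Idx n d → K) :=
  Projectivization.lift
    (fun x => Projectivization.mk K (monomialVector n d x.1) (monomialVector_ne_zero n d x.2))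
    (by
      intro a b t h
      rw [Projectivization.mk_eq_mk_iff']
      exact ⟨t ^ d, by rw [h, monomialVector_smul]⟩)

/-- The Veronese variety `V_{n,d} = ν_d(ℙⁿ) ⊂ ℙᴺ`, as a set of points. -/
def veroneseVariety (K : Type*) [Field K] (n d : ℕ) : Set (ℙ K (Idx n d → K)) :=
  Set.range (veroneseMap K n d)

/-- The homogeneous ideal of a set `X` of points of a projective space: the ideal generated by the
homogeneous polynomials that vanish at (every coordinate vector of) every point of `X`. -/
def homogeneousIdeal {σ : Type*} (X : Set (ℙ K (σ → K))) : Ideal (MvPolynomial σ K) :=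
  Ideal.span {F | (∃ m : ℕ, F.IsHomogeneous m) ∧
    ∀ (v : σ → K) (hv : v ≠ 0), Projectivization.mk K v hv ∈ X → eval v F = 0}

/-- `F` is a quadratic form of rank `r` (over a field of characteristic different from `2`):
`F = ∑ M_{ij} z_i z_j` with `M` symmetric of rank `r`. -/
def IsQuadricOfRank {σ : Type*} [Fintype σ] (F : MvPolynomial σ K) (r : ℕ) : Prop :=
  ∃ M : Matrix σ σ K, M.IsSymm ∧ M.rank = r ∧ F = ∑ i, ∑ j, C (M i j) * X i * X j

end Geometry

section Quadrics

variable {K : Type*} [Field K]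

/-- `H⁰(ℙⁿ, 𝒪(k))`: the forms of degree `k` in `x_0, …, x_n`. -/
abbrev Sec (K : Type*) [Field K] (n k : ℕ) : Submodule K (MvPolynomial (Fin (n + 1)) K) :=
  homogeneousSubmodule (Fin (n + 1)) K k

/-- The natural isomorphism `φ` from `H⁰(ℙⁿ, 𝒪(d))` onto the linear forms on `ℙᴺ`, sending the
monomial `x^I` to the coordinate `z_I`. -/
def phi (n d : ℕ) : Sec K n d →ₗ[K] MvPolynomial (Idx n d) K :=
  ∑ I : Idx n d,
    ((lcoeff K I.1).comp (Sec K n d).subtype).smulRight (X I : MvPolynomial (Idx n d) K)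

/-- The product `s ⊗ t ⊗ h ∈ H⁰(ℙⁿ, 𝒪(d))` for `s, t ∈ H⁰(ℙⁿ, 𝒪(ℓ))` and `h ∈ H⁰(ℙⁿ, 𝒪(m))`,
where `d = 2ℓ + m`. -/
def tripleProd {n ℓ m d : ℕ} (hd : 2 * ℓ + m = d) (s t : Sec K n ℓ) (h : Sec K n m) :
    Sec K n d :=
  ⟨s.1 * t.1 * h.1, by
    rw [mem_homogeneousSubmodule, ← hd, two_mul]
    exact (IsHomogeneous.mul s.2 t.2).mul h.2⟩

/-- `Q(s,t,h) = φ(s ⊗ s ⊗ h) φ(t ⊗ t ⊗ h) - φ(s ⊗ t ⊗ h)²`. -/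
def Q {n ℓ m d : ℕ} (hd : 2 * ℓ + m = d) (s t : Sec K n ℓ) (h : Sec K n m) :
    MvPolynomial (Idx n d) K :=
  phi n d (tripleProd hd s s h) * phi n d (tripleProd hd t t h) -
    phi n d (tripleProd hd s t h) ^ 2

/-- `Δ₁ = {(i,j) | i < j}`. -/
def Delta1 (p : ℕ) : Set (Fin p × Fin p) := {x | x.1 < x.2}

/-- `Δ₂ = {(i,j,k) | (i,j) ∈ Δ₁, k ≠ i, j}`. -/
def Delta2 (p : ℕ) : Set (Fin p × Fin p × Fin p) :=
  {x | (x.1, x.2.1) ∈ Delta1 p ∧ x.2.2 ≠ x.1 ∧ x.2.2 ≠ x.2.1}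

/-- `Δ₃ = {(i,j,k,l) | (i,j), (k,l) ∈ Δ₁, i < k, j ≠ k, l}`. -/
def Delta3 (p : ℕ) : Set (Fin p × Fin p × Fin p × Fin p) :=
  {x | (x.1, x.2.1) ∈ Delta1 p ∧ (x.2.2.1, x.2.2.2) ∈ Delta1 p ∧ x.1 < x.2.2.1 ∧
    x.2.1 ≠ x.2.2.1 ∧ x.2.1 ≠ x.2.2.2}

/-- `H = {h_1, …, h_q} ∪ {h_i + h_j | i < j}`. -/
def sumSet {V : Type*} [AddCommGroup V] {q : ℕ} (h : Fin q → V) : Set V :=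
  {g | ∃ i, g = h i} ∪ {g | ∃ i j, i < j ∧ g = h i + h j}

/-- `Γ₁₁ = {Q(s_i, s_j, h) | (i,j) ∈ Δ₁, h ∈ H}`. -/
def Gamma11 {n ℓ m d p q : ℕ} (hd : 2 * ℓ + m = d) (s : Fin p → Sec K n ℓ)
    (h : Fin q → Sec K n m) : Set (MvPolynomial (Idx n d) K) :=
  {F | ∃ i j, (i, j) ∈ Delta1 p ∧ ∃ g ∈ sumSet h, F = Q hd (s i) (s j) g}

/-- `Γ₁₂ = {Q(s_i + s_j, s_k, h) | (i,j,k) ∈ Δ₂, h ∈ H}`. -/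
def Gamma12 {n ℓ m d p q : ℕ} (hd : 2 * ℓ + m = d) (s : Fin p → Sec K n ℓ)
    (h : Fin q → Sec K n m) : Set (MvPolynomial (Idx n d) K) :=
  {F | ∃ i j k, (i, j, k) ∈ Delta2 p ∧ ∃ g ∈ sumSet h, F = Q hd (s i + s j) (s k) g}

/-- `Γ₂₂ = {Q(s_i + s_j, s_k + s_l, h) | (i,j,k,l) ∈ Δ₃, h ∈ H}`. -/
def Gamma22 {n ℓ m d p q : ℕ} (hd : 2 * ℓ + m = d) (s : Fin p → Sec K n ℓ)
    (h : Fin q → Sec K n m) : Set (MvPolynomial (Idx n d) K) :=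
  {F | ∃ i j k l, (i, j, k, l) ∈ Delta3 p ∧ ∃ g ∈ sumSet h,
    F = Q hd (s i + s j) (s k + s l) g}

/-- `Γ(𝒪(ℓ), 𝒪(m)) = Γ₁₁ ∪ Γ₁₂ ∪ Γ₂₂`, for a basis `s` of `H⁰(ℙⁿ, 𝒪(ℓ))` and a basis `h` of
`H⁰(ℙⁿ, 𝒪(m))`. -/
def Gamma {n ℓ m d p q : ℕ} (hd : 2 * ℓ + m = d) (s : Module.Basis (Fin p) K (Sec K n ℓ))
    (h : Module.Basis (Fin q) K (Sec K n m)) : Set (MvPolynomial (Idx n d) K) :=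
  Gamma11 hd s h ∪ Gamma12 hd s h ∪ Gamma22 hd s h

end Quadrics

end Veronese

end

/-!
Put `W(a, b, c, e; g, g') = φ(abg)φ(ceg') + φ(acg)φ(beg') + φ(aeg)φ(bcg')`. For `g = g'` it is
symmetric in the linear forms `a, b, c, e`, and in characteristic three
`W(a, a, b, b; g, g) = Q(a, b, g)` and `W(a, b, b, b; g, g) = 0`. Hence, modulo the ideal generated
by `Γ`, `W(s_i, s_j, s_k, s_l; g, g) = 0` for all indices and all `g ∈ H`, and multilinearity and
polarization in `g` give `W(a, b, c, e; g, g') + W(a, b, c, e; g', g) = 0` for all linear forms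
`a, b, c, e` and all `g, g'` of degree `d - 2`. On monomials these are six-term relations between
the products `z_A z_B`. Consider the defect `D(T, T')` of exchanging two fixed variables between
the factors of a product; the difference of two six-term relations is a three-term relation for
`D`. For `d ≥ 4` it shows that `D(T, T')` depends only on the product of the monomials `T` and
`T'`, so that `D`, being antisymmetric, vanishes; for `d = 3` two instances of it give `2 D = 0`.
Therefore `z_A z_B` depends only on `A + B` modulo `Γ`, and the binomials expressing this generate
the toric ideal of the Veronese variety.
-/

noncomputable section

namespace Veronese

section Exchange

variable {α β : Type*}

theorem eq_of_add_eq_add_of_exchange {i j : ℕ} {G : Multiset α → Multiset α → β}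
    (hG : ∀ S S' c e, S.card + 1 = i → S'.card + 1 = j →
      G (c ::ₘ S) (e ::ₘ S') = G (e ::ₘ S) (c ::ₘ S'))
    {A B A' B' : Multiset α} (hA : A.card = i) (hB : B.card = j) (hA' : A'.card = i)
    (h : A + B = A' + B') : G A B = G A' B' := by
  induction A using Multiset.induction_on generalizing G A' B' i with
  | empty =>
    obtain rfl : A' = 0 := Multiset.card_eq_zero.mp (hA'.trans hA.symm)
    rw [add_left_cancel h]
  | cons c A ih =>
    rw [Multiset.card_cons] at hA
    have cancel_head : ∀ {S B'}, S.card = A.card → A + B = S + B' →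
        G (c ::ₘ A) B = G (c ::ₘ S) B' := fun hS h =>
      ih (G := fun T T' => G (c ::ₘ T) T')
        (fun T T' x y hT hT' => by
          rw [Multiset.cons_swap c x, Multiset.cons_swap c y]
          exact hG (c ::ₘ T) T' x y (by rw [Multiset.card_cons]; omega) hT')
        rfl hS h
    by_cases hc : c ∈ A'
    · obtain ⟨S, rfl⟩ := Multiset.exists_cons_of_mem hc
      rw [Multiset.card_cons] at hA'
      rw [Multiset.cons_add, Multiset.cons_add] at h
      exact cancel_head (by omega) ((Multiset.cons_inj_right c).mp h)
    · have hcB : c ∈ B' := by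
        have : c ∈ A' + B' := h ▸ by simp
        exact (Multiset.mem_add.mp this).resolve_left hc
      obtain ⟨S', rfl⟩ := Multiset.exists_cons_of_mem hcB
      obtain ⟨e, S, rfl⟩ : ∃ e S, A' = e ::ₘ S := by
        obtain ⟨e, he⟩ := Multiset.card_pos_iff_exists_mem.mp (by omega : 0 < A'.card)
        exact ⟨e, Multiset.exists_cons_of_mem he⟩
      have hcard := congrArg Multiset.card h
      simp only [Multiset.card_add, Multiset.card_cons] at hcard hA'
      rw [hG S S' e c hA' (by omega)]
      refine cancel_head (by omega) ((Multiset.cons_inj_right c).mp ?_)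
      rw [← Multiset.cons_add, h, Multiset.cons_add, Multiset.add_cons, Multiset.add_cons,
        Multiset.cons_swap]

variable {M : Type*} [AddCommGroup M]

/-- The sum of `F` over the six ways of distributing `a, b, c, e` evenly among the two
arguments. -/
def sixTerm (F : Multiset α → Multiset α → M) (S S' : Multiset α) (a b c e : α) : M :=
  F (a ::ₘ b ::ₘ S) (c ::ₘ e ::ₘ S') + F (a ::ₘ c ::ₘ S) (b ::ₘ e ::ₘ S') +
  F (a ::ₘ e ::ₘ S) (b ::ₘ c ::ₘ S') + F (b ::ₘ c ::ₘ S) (a ::ₘ e ::ₘ S') +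
  F (b ::ₘ e ::ₘ S) (a ::ₘ c ::ₘ S') + F (c ::ₘ e ::ₘ S) (a ::ₘ b ::ₘ S')

/-- The defect of the exchange of `a` and `b` between the two arguments of `F`. -/
def swapDiff (F : Multiset α → Multiset α → M) (a b : α) (T T' : Multiset α) : M :=
  F (a ::ₘ T) (b ::ₘ T') - F (b ::ₘ T) (a ::ₘ T')

variable {F : Multiset α → Multiset α → M} {d : ℕ}

theorem swapDiff_antisymm (symm : ∀ A B, F A B = F B A) (a b : α) (T T' : Multiset α) :
    swapDiff F a b T T' = -swapDiff F a b T' T := by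
  rw [swapDiff, swapDiff, symm (a ::ₘ T), symm (b ::ₘ T), neg_sub]

theorem swapDiff_three_term
    (rel : ∀ S S' a b c e, S.card + 2 = d → S'.card + 2 = d → sixTerm F S S' a b c e = 0)
    {S S' : Multiset α} (hS : S.card + 2 = d) (hS' : S'.card + 3 = d) (a b t u v : α) :
    swapDiff F a b (t ::ₘ S) (u ::ₘ v ::ₘ S') + swapDiff F a b (u ::ₘ S) (t ::ₘ v ::ₘ S') +
      swapDiff F a b (v ::ₘ S) (t ::ₘ u ::ₘ S') = 0 := by
  have hb := rel S (b ::ₘ S') a t u v hS (by rw [Multiset.card_cons]; omega)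
  have ha := rel S (a ::ₘ S') b t u v hS (by rw [Multiset.card_cons]; omega)
  rw [← sub_eq_zero_of_eq (hb.trans ha.symm)]
  simp only [sixTerm, swapDiff, Multiset.cons_swap]
  abel

theorem swapDiff_exchange_of_four_le
    (rel : ∀ S S' a b c e, S.card + 2 = d → S'.card + 2 = d → sixTerm F S S' a b c e = 0)
    (hd : 4 ≤ d) {S S' : Multiset α} (hS : S.card + 2 = d) (hS' : S'.card + 2 = d)
    (a b c e : α) :
    swapDiff F a b (c ::ₘ S) (e ::ₘ S') = swapDiff F a b (e ::ₘ S) (c ::ₘ S') := by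
  obtain ⟨x, S', rfl⟩ : ∃ x T, S' = x ::ₘ T := by
    obtain ⟨x, hx⟩ := Multiset.card_pos_iff_exists_mem.mp (by omega : 0 < S'.card)
    exact ⟨x, Multiset.exists_cons_of_mem hx⟩
  rw [Multiset.card_cons] at hS'
  obtain ⟨y, S', rfl⟩ : ∃ y T, S' = y ::ₘ T := by
    obtain ⟨y, hy⟩ := Multiset.card_pos_iff_exists_mem.mp (by omega : 0 < S'.card)
    exact ⟨y, Multiset.exists_cons_of_mem hy⟩
  have hc := swapDiff_three_term rel hS (S' := e ::ₘ S') (by simpa using hS') a b c x y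
  have he := swapDiff_three_term rel hS (S' := c ::ₘ S') (by simpa using hS') a b e x y
  simp only [Multiset.cons_swap] at hc he ⊢
  exact add_right_cancel (add_right_cancel (hc.trans he.symm))

theorem swapDiff_eq_zero_of_four_le (two_torsion_free : ∀ x : M, x + x = 0 → x = 0)
    (symm : ∀ A B, F A B = F B A)
    (rel : ∀ S S' a b c e, S.card + 2 = d → S'.card + 2 = d → sixTerm F S S' a b c e = 0)
    (hd : 4 ≤ d) {T T' : Multiset α} (hT : T.card + 1 = d) (hT' : T'.card + 1 = d) (a b : α) :
    swapDiff F a b T T' = 0 := by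
  have comm : swapDiff F a b T T' = swapDiff F a b T' T :=
    eq_of_add_eq_add_of_exchange (i := d - 1) (j := d - 1)
      (fun S S' c e hS hS' =>
        swapDiff_exchange_of_four_le rel hd (by omega) (by omega) a b c e)
      (by omega) (by omega) (by omega) (add_comm T T')
  refine two_torsion_free _ ?_
  nth_rw 1 [comm, swapDiff_antisymm symm]
  exact neg_add_cancel _

theorem swapDiff_eq_zero_of_eq_three (two_torsion_free : ∀ x : M, x + x = 0 → x = 0)
    (symm : ∀ A B, F A B = F B A)
    (rel : ∀ S S' a b c e, S.card + 2 = 3 → S'.card + 2 = 3 → sixTerm F S S' a b c e = 0)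
    {T T' : Multiset α} (hT : T.card + 1 = 3) (hT' : T'.card + 1 = 3) (a b : α) :
    swapDiff F a b T T' = 0 := by
  obtain ⟨s, t, rfl⟩ := Multiset.card_eq_two.mp (by omega : T.card = 2)
  obtain ⟨u, v, rfl⟩ := Multiset.card_eq_two.mp (by omega : T'.card = 2)
  have hs := swapDiff_three_term rel (S := {s}) (S' := 0) rfl rfl a b t u v
  have ht := swapDiff_three_term rel (S := {t}) (S' := 0) rfl rfl a b s u v
  rw [swapDiff_antisymm symm a b (u ::ₘ {t}), swapDiff_antisymm symm a b (v ::ₘ {t})] at ht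
  have hst := (congrArg₂ (· + ·) hs ht).trans (add_zero 0)
  refine two_torsion_free _ (Eq.trans ?_ hst)
  simp only [Multiset.insert_eq_cons, ← Multiset.cons_zero, Multiset.cons_swap]
  abel

theorem eq_of_add_eq_add (two_torsion_free : ∀ x : M, x + x = 0 → x = 0)
    (symm : ∀ A B, F A B = F B A)
    (rel : ∀ S S' a b c e, S.card + 2 = d → S'.card + 2 = d → sixTerm F S S' a b c e = 0)
    (hd : 3 ≤ d) {A B A' B' : Multiset α} (hA : A.card = d) (hB : B.card = d)
    (hA' : A'.card = d) (h : A + B = A' + B') : F A B = F A' B' := by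
  refine eq_of_add_eq_add_of_exchange (fun T T' a b hT hT' => sub_eq_zero.mp ?_) hA hB hA' h
  change swapDiff F a b T T' = 0
  rcases hd.lt_or_eq with hd | rfl
  · exact swapDiff_eq_zero_of_four_le two_torsion_free symm rel hd hT hT' a b
  · exact swapDiff_eq_zero_of_eq_three two_torsion_free symm rel hT hT' a b

end Exchange

section Polarization

theorem forall_of_sorted {ι : Type*} [LinearOrder ι] {P : ι → ι → ι → ι → Prop}
    (swap₁₂ : ∀ {i j k l}, P i j k l → P j i k l) (swap₂₃ : ∀ {i j k l}, P i j k l → P i k j l)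
    (swap₃₄ : ∀ {i j k l}, P i j k l → P i j l k)
    (sorted : ∀ {i j k l}, i ≤ j → j ≤ k → k ≤ l → P i j k l) (i j k l : ι) : P i j k l := by
  have sorted_tail : ∀ {i j k l}, j ≤ k → k ≤ l → P i j k l := by
    intro i j k l hjk hkl
    rcases le_total i j with hij | hji
    · exact sorted hij hjk hkl
    rcases le_total i k with hik | hki
    · exact swap₁₂ (sorted hji hik hkl)
    rcases le_total i l with hil | hli
    · exact swap₁₂ (swap₂₃ (sorted hjk hki hil))
    · exact swap₁₂ (swap₂₃ (swap₃₄ (sorted hjk hkl hli)))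
  have sorted_last : ∀ {i j k l}, k ≤ l → P i j k l := by
    intro i j k l hkl
    rcases le_total j k with hjk | hkj
    · exact sorted_tail hjk hkl
    rcases le_total j l with hjl | hlj
    · exact swap₂₃ (sorted_tail hkj hjl)
    · exact swap₂₃ (swap₃₄ (sorted_tail hkl hlj))
  rcases le_total k l with hkl | hlk
  · exact sorted_last hkl
  · exact swap₃₄ (sorted_last hlk)

variable {K A R : Type*} [CommRing K] [CommRing A] [Algebra K A] [CommRing R] [Algebra K R]

/-- The sum of `L (xyg) L (zwg')` over the three partitions of `{a, b, c, e}` into pairs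
`{x, y}`, `{z, w}` with `x = a`. In characteristic three its value at `(g, g, a, a, b, b)` is
`L (a²g) L (b²g) - L (abg)²`. -/
def pairingSum (L : A →ₗ[K] R) (g g' a b c e : A) : R :=
  L (a * b * g) * L (c * e * g') + L (a * c * g) * L (b * e * g') + L (a * e * g) * L (b * c * g')

/-- The symmetrization of `pairingSum` in its first two arguments. -/
def fullPolarization (L : A →ₗ[K] R) (g g' a b c e : A) : R :=
  pairingSum L g g' a b c e + pairingSum L g' g a b c e

variable (L : A →ₗ[K] R)

theorem pairingSum_swap₁₂ (g a b c e : A) :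
    pairingSum L g g b a c e = pairingSum L g g a b c e := by
  simp only [pairingSum, mul_comm b a]
  ring

theorem pairingSum_swap₂₃ (g g' a b c e : A) :
    pairingSum L g g' a c b e = pairingSum L g g' a b c e := by
  simp only [pairingSum, mul_comm c b]
  ring

theorem pairingSum_swap₃₄ (g g' a b c e : A) :
    pairingSum L g g' a b e c = pairingSum L g g' a b c e := by
  simp only [pairingSum, mul_comm e c]
  ring

theorem pairingSum_swap_pairs (g a b c e : A) :
    pairingSum L g g c e a b = pairingSum L g g a b c e := by
  simp only [pairingSum, mul_comm c a, mul_comm c b, mul_comm e a, mul_comm e b]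
  ring

theorem pairingSum_sq (three_eq_zero : (3 : R) = 0) (g a b : A) :
    pairingSum L g g a a b b = L (a * a * g) * L (b * b * g) - L (a * b * g) ^ 2 := by
  rw [pairingSum]
  linear_combination L (a * b * g) ^ 2 * three_eq_zero

theorem pairingSum_cube (three_eq_zero : (3 : R) = 0) (g a b : A) :
    pairingSum L g g a b b b = 0 := by
  rw [pairingSum]
  linear_combination L (a * b * g) * L (b * b * g) * three_eq_zero

theorem pairingSum_add_twist (g g' a b c e : A) :
    pairingSum L (g + g') (g + g') a b c e =
      pairingSum L g g a b c e + pairingSum L g' g' a b c e + fullPolarization L g g' a b c e := by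
  simp only [fullPolarization, pairingSum, mul_add, map_add]
  ring

theorem fullPolarization_comm (g g' a b c e : A) :
    fullPolarization L g' g a b c e = fullPolarization L g g' a b c e := by
  rw [fullPolarization, fullPolarization, add_comm]

theorem fullPolarization_swap₁₂ (g g' a b c e : A) :
    fullPolarization L g g' b a c e = fullPolarization L g g' a b c e := by
  simp only [fullPolarization, pairingSum, mul_comm b a]
  ring

theorem fullPolarization_swap₁₃ (g g' a b c e : A) :
    fullPolarization L g g' c b a e = fullPolarization L g g' a b c e := by
  simp only [fullPolarization, pairingSum, mul_comm b a, mul_comm c a, mul_comm c b]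
  ring

theorem fullPolarization_swap₁₄ (g g' a b c e : A) :
    fullPolarization L g g' e b c a = fullPolarization L g g' a b c e := by
  simp only [fullPolarization, pairingSum, mul_comm b a, mul_comm c a, mul_comm e a, mul_comm e b,
    mul_comm e c]
  ring

theorem isLinearMap_fullPolarization_section (g g' b c e : A) :
    IsLinearMap K (fun a => fullPolarization L g g' a b c e) where
  map_add x y := by
    simp only [fullPolarization, pairingSum, add_mul, map_add]
    ring
  map_smul r x := by
    simp only [fullPolarization, pairingSum, smul_mul_assoc, map_smul, smul_add]

theorem isLinearMap_fullPolarization_twist (g' a b c e : A) :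
    IsLinearMap K (fun g => fullPolarization L g g' a b c e) where
  map_add x y := by
    simp only [fullPolarization, pairingSum, mul_add, map_add]
    ring
  map_smul r x := by
    simp only [fullPolarization, pairingSum, smul_mul_assoc, map_smul, smul_add, mul_smul_comm]

variable {L}

theorem pairingSum_eq_zero_of_add (three_eq_zero : (3 : R) = 0) {g a b x y : A}
    (haa : pairingSum L g g a a x y = 0) (hbb : pairingSum L g g b b x y = 0)
    (hab : pairingSum L g g (a + b) (a + b) x y = 0) : pairingSum L g g a b x y = 0 := by
  have expand : pairingSum L g g (a + b) (a + b) x y =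
      pairingSum L g g a a x y + 2 * pairingSum L g g a b x y + pairingSum L g g b b x y := by
    simp only [pairingSum, add_mul, mul_add, map_add, mul_comm b a]
    ring
  linear_combination haa + hbb - hab + expand + pairingSum L g g a b x y * three_eq_zero

section Family

variable {p : ℕ} {s : Fin p → A} {g : A}

theorem pairingSum_eq_zero_of_pairs (three_eq_zero : (3 : R) = 0)
    (h₁₁ : ∀ i j, (i, j) ∈ Delta1 p → pairingSum L g g (s i) (s i) (s j) (s j) = 0)
    (i j : Fin p) : pairingSum L g g (s i) (s i) (s j) (s j) = 0 := by
  rcases lt_trichotomy i j with hij | rfl | hji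
  · exact h₁₁ i j hij
  · exact pairingSum_cube L three_eq_zero g _ _
  · exact (pairingSum_swap_pairs ..).trans (h₁₁ j i hji)

theorem pairingSum_eq_zero_of_triples (three_eq_zero : (3 : R) = 0)
    (h₁₁ : ∀ i j, (i, j) ∈ Delta1 p → pairingSum L g g (s i) (s i) (s j) (s j) = 0)
    (h₁₂ : ∀ i j k, (i, j, k) ∈ Delta2 p →
      pairingSum L g g (s i + s j) (s i + s j) (s k) (s k) = 0)
    (i j k : Fin p) : pairingSum L g g (s i) (s j) (s k) (s k) = 0 := by
  have of_lt : ∀ {i j}, i < j → pairingSum L g g (s i) (s j) (s k) (s k) = 0 := by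
    intro i j hij
    rcases eq_or_ne k i with rfl | hki
    · exact (pairingSum_swap₁₂ ..).trans (pairingSum_cube L three_eq_zero g _ _)
    rcases eq_or_ne k j with rfl | hkj
    · exact pairingSum_cube L three_eq_zero g _ _
    exact pairingSum_eq_zero_of_add three_eq_zero
      (pairingSum_eq_zero_of_pairs three_eq_zero h₁₁ i k)
      (pairingSum_eq_zero_of_pairs three_eq_zero h₁₁ j k) (h₁₂ i j k ⟨hij, hki, hkj⟩)
  rcases lt_trichotomy i j with hij | rfl | hji
  · exact of_lt hij
  · exact pairingSum_eq_zero_of_pairs three_eq_zero h₁₁ i k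
  · rw [pairingSum_swap₁₂]
    exact of_lt hji

theorem pairingSum_eq_zero_of_family (three_eq_zero : (3 : R) = 0)
    (h₁₁ : ∀ i j, (i, j) ∈ Delta1 p → pairingSum L g g (s i) (s i) (s j) (s j) = 0)
    (h₁₂ : ∀ i j k, (i, j, k) ∈ Delta2 p →
      pairingSum L g g (s i + s j) (s i + s j) (s k) (s k) = 0)
    (h₂₂ : ∀ i j k l, (i, j, k, l) ∈ Delta3 p →
      pairingSum L g g (s i + s j) (s i + s j) (s k + s l) (s k + s l) = 0)
    (i j k l : Fin p) : pairingSum L g g (s i) (s j) (s k) (s l) = 0 := by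
  have triple := pairingSum_eq_zero_of_triples three_eq_zero h₁₁ h₁₂
  have triple' (i j k) : pairingSum L g g (s k) (s k) (s i) (s j) = 0 :=
    (pairingSum_swap_pairs ..).trans (triple i j k)
  refine forall_of_sorted (P := fun i j k l => pairingSum L g g (s i) (s j) (s k) (s l) = 0)
    (pairingSum_swap₁₂ ..).trans (pairingSum_swap₂₃ ..).trans (pairingSum_swap₃₄ ..).trans
    (fun {i j k l} hij hjk hkl => ?_) i j k l
  rcases hij.eq_or_lt with rfl | hij
  · exact triple' k l i
  rcases hkl.eq_or_lt with rfl | hkl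
  · exact triple i j k
  rcases hjk.eq_or_lt with rfl | hjk
  · rw [pairingSum_swap₁₂, pairingSum_swap₂₃]
    exact triple' i l j
  have square_sum (x) (hx : j < x) :
      pairingSum L g g (s x) (s x) (s i + s j) (s i + s j) = 0 :=
    (pairingSum_swap_pairs ..).trans (h₁₂ i j x ⟨hij, (hij.trans hx).ne', hx.ne'⟩)
  refine pairingSum_eq_zero_of_add three_eq_zero (triple' k l i) (triple' k l j) ?_
  rw [pairingSum_swap_pairs]
  refine pairingSum_eq_zero_of_add three_eq_zero (square_sum k hjk)
    (square_sum l (hjk.trans hkl)) ?_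
  rw [pairingSum_swap_pairs]
  exact h₂₂ i j k l ⟨hij, hkl, hij.trans hjk, hjk.ne, (hjk.trans hkl).ne⟩

end Family

section Extension

theorem eq_zero_of_basis {ι M N : Type*} [AddCommGroup M] [Module K M] [AddCommGroup N]
    [Module K N] {P : Submodule K M} (b : Module.Basis ι K P) {f : M → N} (hf : IsLinearMap K f)
    (h : ∀ i, f (b i) = 0) (x : P) : f x = 0 :=
  LinearMap.congr_fun (b.ext (f₁ := hf.mk' f ∘ₗ P.subtype) (f₂ := 0) h) x

variable {p q : ℕ} {P P' : Submodule K A}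

theorem fullPolarization_eq_zero_of_basis (s : Module.Basis (Fin p) K P) {g g' : A}
    (h : ∀ i j k l, fullPolarization L g g' (s i) (s j) (s k) (s l) = 0) (a b c e : P) :
    fullPolarization L g g' a b c e = 0 := by
  have extend (b c e : A) := eq_zero_of_basis s (isLinearMap_fullPolarization_section L g g' b c e)
  refine extend b c e (fun i => ?_) a
  rw [fullPolarization_swap₁₂]
  refine extend _ _ _ (fun j => ?_) b
  rw [fullPolarization_swap₁₃]
  refine extend _ _ _ (fun k => ?_) c
  rw [fullPolarization_swap₁₄]
  exact extend _ _ _ (fun l => h l i j k) e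

theorem fullPolarization_eq_zero_of_twist_basis (h : Module.Basis (Fin q) K P') {a b c e : A}
    (H : ∀ g ∈ sumSet h, pairingSum L (g : A) g a b c e = 0) (g g' : P') :
    fullPolarization L (g : A) g' a b c e = 0 := by
  have of_mem (i) : pairingSum L (h i : A) (h i) a b c e = 0 := H _ (.inl ⟨i, rfl⟩)
  have of_lt {i j} (hij : i < j) : fullPolarization L (h i : A) (h j) a b c e = 0 := by
    have := pairingSum_add_twist L (h i : A) (h j) a b c e
    rwa [of_mem, of_mem, zero_add, zero_add, ← Submodule.coe_add, H _ (.inr ⟨i, j, hij, rfl⟩),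
      eq_comm] at this
  have extend (g' : A) := eq_zero_of_basis h (isLinearMap_fullPolarization_twist L g' a b c e)
  refine extend g' (fun i => ?_) g
  rw [fullPolarization_comm]
  refine extend _ (fun j => ?_) g'
  rcases lt_trichotomy i j with hij | rfl | hji
  · rw [fullPolarization_comm, of_lt hij]
  · rw [fullPolarization, of_mem, add_zero]
  · exact of_lt hji

end Extension

end Polarization

section Generation

variable {K : Type*} [Field K] {n d : ℕ}

/-- The extension of `phi` to all polynomials which ignores the components of degree `≠ d`. It
spares the products of sections of `𝒪(ℓ)` and `𝒪(m)` the bookkeeping of `tripleProd`. -/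
def coordForm (K : Type*) [Field K] (n d : ℕ) :
    MvPolynomial (Fin (n + 1)) K →ₗ[K] MvPolynomial (Idx n d) K :=
  ∑ I : Idx n d, (lcoeff K I.1).smulRight (X I : MvPolynomial (Idx n d) K)

theorem coordForm_apply (g : MvPolynomial (Fin (n + 1)) K) :
    coordForm K n d g = ∑ I : Idx n d, C (coeff I.1 g) * X I := by
  simp [coordForm, MvPolynomial.smul_eq_C_mul]

theorem phi_eq_coordForm (g : Sec K n d) : phi n d g = coordForm K n d g.1 := by
  simp [phi, coordForm]

theorem coordForm_monomial (I : Idx n d) : coordForm K n d (monomial I.1 1) = X I := by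
  classical
  rw [coordForm_apply, Finset.sum_eq_single I]
  · simp
  · intro J _ hJ
    simp [coeff_monomial, Subtype.coe_ne_coe.mpr hJ.symm]
  · simp

theorem Q_eq_coordForm {ℓ m : ℕ} (hd : 2 * ℓ + m = d) (s t : Sec K n ℓ) (h : Sec K n m) :
    Q hd s t h = coordForm K n d (s.1 * s.1 * h.1) * coordForm K n d (t.1 * t.1 * h.1) -
      coordForm K n d (s.1 * t.1 * h.1) ^ 2 := by
  simp only [Q, phi_eq_coordForm, tripleProd]

/-- `coordForm` modulo the ideal `J`. -/
def coordFormMod (J : Ideal (MvPolynomial (Idx n d) K)) :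
    MvPolynomial (Fin (n + 1)) K →ₗ[K] MvPolynomial (Idx n d) K ⧸ J :=
  (Ideal.Quotient.mkₐ K J).toLinearMap ∘ₗ coordForm K n d

theorem coordFormMod_monomial (J : Ideal (MvPolynomial (Idx n d) K)) (I : Idx n d) :
    coordFormMod J (monomial I.1 1) = Ideal.Quotient.mk J (X I) :=
  congrArg (Ideal.Quotient.mk J) (coordForm_monomial I)

theorem three_eq_zero_of_algebra (K R : Type*) [CommRing K] [CharP K 3] [Semiring R] [Algebra K R] :
    (3 : R) = 0 := by
  rw [← map_ofNat (algebraMap K R) 3, CharP.ofNat_eq_zero K 3, map_zero]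

theorem sixTerm_eq_fullPolarization {A R ι : Type*} [CommRing A] [Algebra K A] [CommRing R]
    [Algebra K R] (L : A →ₗ[K] R) (x : ι → A) (S S' : Multiset ι) (a b c e : ι) :
    sixTerm (fun T T' => L (T.map x).prod * L (T'.map x).prod) S S' a b c e =
      fullPolarization L (S.map x).prod (S'.map x).prod (x a) (x b) (x c) (x e) := by
  simp only [sixTerm, fullPolarization, pairingSum, Multiset.map_cons, Multiset.prod_cons,
    ← mul_assoc]
  ring

theorem prod_map_X_toMultiset {σ : Type*} (w : σ →₀ ℕ) :
    (w.toMultiset.map X).prod = (monomial w 1 : MvPolynomial σ K) := by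
  rw [monomial_eq, C_1, one_mul, Finsupp.toMultiset_map, Finsupp.prod_toMultiset,
    Finsupp.prod_mapDomain_index (fun _ => pow_zero _) fun _ _ _ => pow_add _ _ _]

theorem isHomogeneous_prod_map_X {σ : Type*} (S : Multiset σ) :
    ((S.map X).prod : MvPolynomial σ K).IsHomogeneous S.card := by
  induction S using Multiset.induction_on with
  | empty => simpa using isHomogeneous_one σ K
  | cons a S ih =>
    rw [Multiset.map_cons, Multiset.prod_cons, Multiset.card_cons, add_comm]
    exact (isHomogeneous_X K a).mul ih

theorem card_toMultiset_val (I : Idx n d) : I.1.toMultiset.card = d :=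
  (Finsupp.card_toMultiset _).trans ((Finsupp.sum_fintype _ _ fun _ => rfl).trans I.2)

variable [CharP K 3]

theorem pairingSum_coordFormMod (J : Ideal (MvPolynomial (Idx n d) K)) {ℓ m : ℕ}
    (hd : 2 * ℓ + m = d) (a b : Sec K n ℓ) (g : Sec K n m) :
    pairingSum (coordFormMod J) g.1 g.1 a.1 a.1 b.1 b.1 = Ideal.Quotient.mk J (Q hd a b g) := by
  rw [pairingSum_sq _ (three_eq_zero_of_algebra K _), Q_eq_coordForm]
  simp only [map_sub, map_mul, map_pow]
  rfl

theorem fullPolarization_eq_zero_of_Gamma_subset {ℓ m p q : ℕ} {hd : 2 * ℓ + m = d}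
    {s : Module.Basis (Fin p) K (Sec K n ℓ)} {h : Module.Basis (Fin q) K (Sec K n m)}
    {J : Ideal (MvPolynomial (Idx n d) K)} (hJ : Gamma hd s h ⊆ J) (g g' : Sec K n m)
    (a b c e : Sec K n ℓ) :
    fullPolarization (coordFormMod J) g.1 g'.1 a.1 b.1 c.1 e.1 = 0 := by
  have vanish {a b g} (hQ : Q hd a b g ∈ Gamma hd s h) :
      pairingSum (coordFormMod J) g.1 g.1 a.1 a.1 b.1 b.1 = 0 := by
    rw [pairingSum_coordFormMod J hd, Ideal.Quotient.eq_zero_iff_mem]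
    exact hJ hQ
  refine fullPolarization_eq_zero_of_basis s (fun i j k l => ?_) a b c e
  refine fullPolarization_eq_zero_of_twist_basis h (fun g hg => ?_) g g'
  refine pairingSum_eq_zero_of_family (s := fun i => (s i).1) (three_eq_zero_of_algebra K _)
    (fun i j hij => ?_) (fun i j k hijk => ?_) (fun i j k l hijkl => ?_) i j k l
  · exact vanish (.inl (.inl ⟨i, j, hij, g, hg, rfl⟩))
  · exact vanish (a := s i + s j) (.inl (.inr ⟨i, j, k, hijk, g, hg, rfl⟩))
  · exact vanish (a := s i + s j) (b := s k + s l) (.inr ⟨i, j, k, l, hijkl, g, hg, rfl⟩)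

theorem mk_X_mul_mk_X_eq_of_Gamma_subset {m p q : ℕ} {hd : 2 * 1 + m = d} (hd3 : 3 ≤ d)
    {s : Module.Basis (Fin p) K (Sec K n 1)} {h : Module.Basis (Fin q) K (Sec K n m)}
    {J : Ideal (MvPolynomial (Idx n d) K)} (hJ : Gamma hd s h ⊆ J) {A B A' B' : Idx n d}
    (hAB : A.1 + B.1 = A'.1 + B'.1) :
    Ideal.Quotient.mk J (X A) * Ideal.Quotient.mk J (X B) =
      Ideal.Quotient.mk J (X A') * Ideal.Quotient.mk J (X B') := by
  let x (i : Fin (n + 1)) : Sec K n 1 := ⟨X i, isHomogeneous_X K i⟩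
  let w (S : Multiset (Fin (n + 1))) (hS : S.card + 2 = d) : Sec K n m :=
    ⟨(S.map X).prod, by
      obtain rfl : S.card = m := by omega
      exact isHomogeneous_prod_map_X S⟩
  have rel (S S' : Multiset (Fin (n + 1))) (a b c e) (hS : S.card + 2 = d)
      (hS' : S'.card + 2 = d) :
      sixTerm (fun T T' => coordFormMod J (T.map X).prod * coordFormMod J (T'.map X).prod)
        S S' a b c e = 0 := by
    rw [sixTerm_eq_fullPolarization]
    exact fullPolarization_eq_zero_of_Gamma_subset hJ (w S hS) (w S' hS') (x a) (x b) (x c) (x e)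
  have three_eq_zero := three_eq_zero_of_algebra K (MvPolynomial (Idx n d) K ⧸ J)
  have two_torsion_free (y : MvPolynomial (Idx n d) K ⧸ J) (hy : y + y = 0) : y = 0 := by
    linear_combination y * three_eq_zero - hy
  have key := eq_of_add_eq_add two_torsion_free (fun T T' => mul_comm _ _) rel hd3
    (card_toMultiset_val A) (card_toMultiset_val B) (card_toMultiset_val A')
    (B' := B'.1.toMultiset) (by rw [← map_add, hAB, map_add])
  simpa only [prod_map_X_toMultiset, coordFormMod_monomial] using key

end Generation

section Toric

variable {K : Type*} [Field K] {n d : ℕ}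

/-- The `K`-algebra homomorphism `z_I ↦ x^I`, whose kernel is the toric ideal of the Veronese
variety. -/
def pullback (K : Type*) [Field K] (n d : ℕ) :
    MvPolynomial (Idx n d) K →ₐ[K] MvPolynomial (Fin (n + 1)) K :=
  aeval fun I => monomial I.1 1

/-- The exponent of the monomial to which `pullback` sends `∏_{I ∈ L} z_I`. -/
def totalExponent (L : Multiset (Idx n d)) : Fin (n + 1) →₀ ℕ := (L.map Subtype.val).sum

theorem totalExponent_cons (A : Idx n d) (L : Multiset (Idx n d)) :
    totalExponent (A ::ₘ L) = A.1 + totalExponent L := by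
  rw [totalExponent, Multiset.map_cons, Multiset.sum_cons, totalExponent]

theorem degree_val (I : Idx n d) : I.1.degree = d := (Finsupp.degree_eq_sum _).trans I.2

theorem degree_totalExponent (L : Multiset (Idx n d)) : (totalExponent L).degree = L.card * d := by
  induction L using Multiset.induction_on with
  | empty => simp [totalExponent]
  | cons A L ih =>
    rw [totalExponent_cons, map_add, degree_val, ih, Multiset.card_cons, add_one_mul, add_comm]

theorem eq_of_val_le {A B : Idx n d} (h : A.1 ≤ B.1) : A = B := by
  obtain ⟨C, hC⟩ := exists_add_of_le h
  have hdeg := congrArg Finsupp.degree hC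
  rw [map_add, degree_val, degree_val, left_eq_add, Finsupp.degree_eq_zero_iff] at hdeg
  exact Subtype.ext (by rw [hC, hdeg, add_zero])

theorem card_eq_of_totalExponent_eq (hd : 0 < d) {L L' : Multiset (Idx n d)}
    (h : totalExponent L = totalExponent L') : L.card = L'.card := by
  have := congrArg Finsupp.degree h
  rw [degree_totalExponent, degree_totalExponent] at this
  exact Nat.eq_of_mul_eq_mul_right hd this

theorem pullback_prod_X (L : Multiset (Idx n d)) :
    pullback K n d (L.map X).prod = monomial (totalExponent L) 1 := by
  induction L using Multiset.induction_on with
  | empty => simp [totalExponent]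
  | cons A L ih =>
    rw [Multiset.map_cons, Multiset.prod_cons, map_mul, ih, totalExponent_cons, pullback, aeval_X,
      monomial_mul, one_mul]

section Products

variable {S : Type*} [CommMonoid S] {f : Idx n d → S}

theorem exists_exchange {A I : Idx n d} {w : Fin (n + 1) →₀ ℕ} (hA : A.1 ≤ I.1 + w)
    (hw : d ≤ w.degree) : ∃ B C : Idx n d, B.1 ≤ w ∧ I.1 + B.1 = A.1 + C.1 := by
  obtain ⟨E, rfl⟩ := exists_add_of_le (tsub_le_iff_left.mpr hA)
  have hAI : (A.1 - I.1).degree ≤ d := (Finsupp.degree_mono tsub_le_self).trans_eq (degree_val A)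
  rw [map_add] at hw
  obtain ⟨D, hDE, hD⟩ := E.exists_le_degree_eq (d - (A.1 - I.1).degree) (by omega)
  let B : Idx n d := ⟨A.1 - I.1 + D, by rw [← Finsupp.degree_eq_sum, map_add]; omega⟩
  obtain ⟨C, hC⟩ : ∃ C, I.1 + B.1 = A.1 + C :=
    exists_add_of_le (tsub_le_iff_left.mp le_self_add)
  have hCdeg : C.degree = d := by
    have := congrArg Finsupp.degree hC
    rw [map_add, degree_val, degree_val, map_add, degree_val] at this
    exact (add_left_cancel this).symm
  exact ⟨B, ⟨C, (Finsupp.degree_eq_sum C).symm.trans hCdeg⟩, add_le_add_right hDE _, hC⟩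

theorem exists_prod_eq_mul
    (hf : ∀ A B A' B' : Idx n d, A.1 + B.1 = A'.1 + B'.1 → f A * f B = f A' * f B')
    {L : Multiset (Idx n d)} (hL : L ≠ 0) {A : Idx n d} (hA : A.1 ≤ totalExponent L) :
    ∃ L', totalExponent L = A.1 + totalExponent L' ∧ (L.map f).prod = f A * (L'.map f).prod := by
  induction L using Multiset.induction_on generalizing A with
  | empty => exact absurd rfl hL
  | cons I L ih =>
    rw [totalExponent_cons] at hA ⊢
    rcases eq_or_ne L 0 with rfl | hL0
    · obtain rfl : A = I := eq_of_val_le (by simpa [totalExponent] using hA)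
      exact ⟨0, rfl, by simp⟩
    · obtain ⟨B, C, hB, hIB⟩ := exists_exchange hA (by
        rw [degree_totalExponent]
        exact Nat.le_mul_of_pos_left d (Multiset.card_pos.mpr hL0))
      obtain ⟨L', hL', hprod⟩ := ih hL0 hB
      refine ⟨C ::ₘ L', ?_, ?_⟩
      · rw [totalExponent_cons, hL', ← add_assoc, ← add_assoc, hIB]
      · rw [Multiset.map_cons, Multiset.prod_cons, Multiset.map_cons, Multiset.prod_cons, hprod,
          ← mul_assoc, ← mul_assoc, hf I B A C hIB]

theorem prod_eq_of_totalExponent_eq (hd : 0 < d)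
    (hf : ∀ A B A' B' : Idx n d, A.1 + B.1 = A'.1 + B'.1 → f A * f B = f A' * f B')
    {L L' : Multiset (Idx n d)} (h : totalExponent L = totalExponent L') :
    (L.map f).prod = (L'.map f).prod := by
  have card_eq := card_eq_of_totalExponent_eq hd h
  induction L using Multiset.induction_on generalizing L' with
  | empty => rw [Multiset.card_eq_zero.mp (card_eq.symm.trans Multiset.card_zero)]
  | cons A L ih =>
    rw [Multiset.card_cons] at card_eq
    rw [totalExponent_cons] at h
    obtain ⟨L'', hexp, hprod⟩ := exists_prod_eq_mul hf
      (Multiset.card_pos.mp (by omega : 0 < L'.card)) (h ▸ le_self_add)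
    have htail : totalExponent L = totalExponent L'' := add_left_cancel (h.trans hexp)
    rw [hprod, Multiset.map_cons, Multiset.prod_cons,
      ih htail (card_eq_of_totalExponent_eq hd htail)]

end Products

theorem ker_pullback_le (hd : 0 < d) {J : Ideal (MvPolynomial (Idx n d) K)}
    (hJ : ∀ A B A' B' : Idx n d, A.1 + B.1 = A'.1 + B'.1 →
      Ideal.Quotient.mk J (X A) * Ideal.Quotient.mk J (X B) =
        Ideal.Quotient.mk J (X A') * Ideal.Quotient.mk J (X B')) :
    RingHom.ker (pullback K n d) ≤ J := by
  let residueProd (L : Multiset (Idx n d)) : MvPolynomial (Idx n d) K ⧸ J :=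
    (L.map fun A => Ideal.Quotient.mk J (X A)).prod
  let ψ : MvPolynomial (Fin (n + 1)) K →ₗ[K] MvPolynomial (Idx n d) K ⧸ J :=
    (basisMonomials (Fin (n + 1)) K).constr K (Function.extend totalExponent residueProd 0)
  have hψ (L : Multiset (Idx n d)) : ψ (monomial (totalExponent L) 1) = residueProd L := by
    have factors : residueProd.FactorsThrough totalExponent :=
      fun L L' h => prod_eq_of_totalExponent_eq hd hJ h
    exact ((basisMonomials _ K).constr_basis K _ _).trans (factors.extend_apply 0 L)
  have ψ_pullback : ψ ∘ₗ (pullback K n d).toLinearMap = (Ideal.Quotient.mkₐ K J).toLinearMap := by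
    refine (basisMonomials (Idx n d) K).ext fun u => ?_
    simp only [coe_basisMonomials, ← prod_map_X_toMultiset]
    rw [LinearMap.comp_apply, AlgHom.toLinearMap_apply, AlgHom.toLinearMap_apply, pullback_prod_X,
      hψ, map_multiset_prod, Multiset.map_map]
    rfl
  intro F hF
  have := LinearMap.congr_fun ψ_pullback F
  rw [LinearMap.comp_apply, AlgHom.toLinearMap_apply, RingHom.mem_ker.mp hF, map_zero] at this
  exact Ideal.Quotient.eq_zero_iff_mem.mp this.symm

end Toric

section Ideal

variable {K : Type*} [Field K] {n d : ℕ}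

theorem eval_pullback (x : Fin (n + 1) → K) (F : MvPolynomial (Idx n d) K) :
    eval x (pullback K n d F) = eval (monomialVector n d x) F := by
  induction F using MvPolynomial.induction_on with
  | C a => simp [pullback]
  | add F G hF hG => rw [map_add, map_add, map_add, hF, hG]
  | mul_X F I hF =>
    rw [map_mul, map_mul, map_mul, hF, eval_X, pullback, aeval_X, eval_monomial, one_mul,
      Finsupp.prod_fintype _ _ fun _ => pow_zero _, monomialVector]

theorem mk_monomialVector_mem {x : Fin (n + 1) → K} (hx : x ≠ 0) :
    Projectivization.mk K (monomialVector n d x) (monomialVector_ne_zero n d hx) ∈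
      veroneseVariety K n d :=
  ⟨Projectivization.mk K x hx, rfl⟩

theorem exists_eq_smul_of_mem {v : Idx n d → K} (hv : v ≠ 0)
    (h : Projectivization.mk K v hv ∈ veroneseVariety K n d) :
    ∃ (a : K) (x : Fin (n + 1) → K), v = a • monomialVector n d x := by
  obtain ⟨P, hP⟩ := h
  induction P using Projectivization.ind with
  | h x hx =>
    obtain ⟨a, ha⟩ := (Projectivization.mk_eq_mk_iff' K _ _ _ _).mp hP.symm
    exact ⟨a, x, ha.symm⟩

theorem homogeneousIdeal_le_ker_pullback [Infinite K] :
    homogeneousIdeal (veroneseVariety K n d) ≤ RingHom.ker (pullback K n d) := by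
  rw [homogeneousIdeal, Ideal.span_le]
  rintro F ⟨-, hF⟩
  -- The factor `X 0` takes care of the point `x = 0`, which has no image in projective space.
  have h : X 0 * pullback K n d F = 0 := by
    refine MvPolynomial.funext fun x => ?_
    rw [map_mul, eval_X, map_zero, eval_pullback]
    rcases eq_or_ne x 0 with rfl | hx
    · rw [Pi.zero_apply, zero_mul]
    · rw [hF _ _ (mk_monomialVector_mem hx), mul_zero]
  exact (mul_eq_zero.mp h).resolve_left (X_ne_zero 0)

theorem eval_smul_of_isHomogeneous {σ : Type*} {F : MvPolynomial σ K} {m : ℕ}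
    (hF : F.IsHomogeneous m) (a : K) (v : σ → K) : eval (a • v) F = a ^ m * eval v F := by
  rw [eval_eq, eval_eq, Finset.mul_sum]
  refine Finset.sum_congr rfl fun w hw => ?_
  simp only [Pi.smul_apply, smul_eq_mul, mul_pow, Finset.prod_mul_distrib]
  rw [Finset.prod_pow_eq_pow_sum, ← hF.degree_eq_sum_deg_support hw, mul_left_comm]

theorem mem_homogeneousIdeal_of_pullback_eq_zero {F : MvPolynomial (Idx n d) K} {m : ℕ}
    (hF : F.IsHomogeneous m) (h : pullback K n d F = 0) :
    F ∈ homogeneousIdeal (veroneseVariety K n d) := by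
  refine Ideal.subset_span ⟨⟨m, hF⟩, fun v hv hmem => ?_⟩
  obtain ⟨a, x, rfl⟩ := exists_eq_smul_of_mem hv hmem
  rw [eval_smul_of_isHomogeneous hF, ← eval_pullback, h, map_zero, mul_zero]

theorem pullback_coordForm (g : MvPolynomial (Fin (n + 1)) K) :
    pullback K n d (coordForm K n d g) = homogeneousComponent d g := by
  ext w
  simp only [coordForm_apply, pullback, map_sum, map_mul, aeval_C, aeval_X, algebraMap_eq,
    C_mul_monomial, mul_one, coeff_sum, coeff_monomial, coeff_homogeneousComponent]
  by_cases hw : w.degree = d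
  · rw [if_pos hw, Finset.sum_eq_single ⟨w, w.degree_eq_sum.symm.trans hw⟩]
    · exact if_pos rfl
    · exact fun I _ hI => if_neg fun h => hI (Subtype.ext h)
    · exact fun h => absurd (Finset.mem_univ _) h
  · rw [if_neg hw]
    exact Finset.sum_eq_zero fun I _ => if_neg (by rintro rfl; exact hw (degree_val I))

theorem pullback_phi (g : Sec K n d) : pullback K n d (phi n d g) = g.1 := by
  rw [phi_eq_coordForm, pullback_coordForm, homogeneousComponent_eq_self g.2]

theorem isHomogeneous_phi (g : Sec K n d) : (phi n d g).IsHomogeneous 1 := by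
  rw [phi_eq_coordForm, coordForm_apply]
  exact IsHomogeneous.sum _ _ _ fun I _ => isHomogeneous_C_mul_X _ I

theorem Q_mem_homogeneousIdeal {ℓ m : ℕ} (hd : 2 * ℓ + m = d) (s t : Sec K n ℓ) (h : Sec K n m) :
    Q hd s t h ∈ homogeneousIdeal (veroneseVariety K n d) := by
  refine mem_homogeneousIdeal_of_pullback_eq_zero (m := 2) ?_ ?_
  · exact ((isHomogeneous_phi _).mul (isHomogeneous_phi _)).sub ((isHomogeneous_phi _).pow 2)
  · simp only [Q, tripleProd, map_sub, map_mul, map_pow, pullback_phi]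
    ring

end Ideal

section Generators

theorem linearIndependent_pair_of_dual {K V : Type*} [Field K] [AddCommGroup V] [Module K V]
    {v w : V} (f g : V →ₗ[K] K) (hfv : f v = 1) (hfw : f w = 0) (hgw : g w = 1) :
    LinearIndependent K ![v, w] := by
  refine LinearIndependent.pair_iff.mpr fun x y hxy => ?_
  have hx : x = 0 := by simpa [hfv, hfw] using congrArg f hxy
  subst hx
  exact ⟨rfl, by simpa [hgw] using congrArg g hxy⟩

theorem ne_zero_of_mem_sumSet {R V : Type*} [Ring R] [Nontrivial R] [AddCommGroup V] [Module R V]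
    {q : ℕ} (h : Module.Basis (Fin q) R V) {g : V} (hg : g ∈ sumSet h) : g ≠ 0 := by
  rcases hg with ⟨i, rfl⟩ | ⟨i, j, hij, rfl⟩
  · exact h.ne_zero i
  · intro h0
    simpa [hij.ne'] using congrArg (h.coord i) h0

theorem finite_sumSet {V : Type*} [AddCommGroup V] {q : ℕ} (h : Fin q → V) :
    (sumSet h).Finite := by
  refine Set.Finite.union ((Set.finite_range h).subset ?_)
    ((Set.finite_range fun x : Fin q × Fin q => h x.1 + h x.2).subset ?_)
  · rintro _ ⟨i, rfl⟩
    exact ⟨i, rfl⟩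
  · rintro _ ⟨i, j, -, rfl⟩
    exact ⟨(i, j), rfl⟩

variable {K : Type*} [Field K] {n d ℓ m p q : ℕ}

theorem finite_Gamma (hd : 2 * ℓ + m = d)
    (s : Module.Basis (Fin p) K (Sec K n ℓ)) (h : Module.Basis (Fin q) K (Sec K n m)) :
    (Gamma hd s h).Finite := by
  have hs : (Set.range s ∪ Set.range fun x : Fin p × Fin p => s x.1 + s x.2).Finite :=
    (Set.finite_range _).union (Set.finite_range _)
  refine (((hs.prod hs).prod (finite_sumSet h)).image fun x => Q hd x.1.1 x.1.2 x.2).subset ?_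
  rintro _ ((⟨i, j, -, g, hg, rfl⟩ | ⟨i, j, k, -, g, hg, rfl⟩) | ⟨i, j, k, l, -, g, hg, rfl⟩)
  · exact ⟨((s i, s j), g), ⟨⟨Or.inl ⟨i, rfl⟩, Or.inl ⟨j, rfl⟩⟩, hg⟩, rfl⟩
  · exact ⟨((s i + s j, s k), g), ⟨⟨Or.inr ⟨(i, j), rfl⟩, Or.inl ⟨k, rfl⟩⟩, hg⟩, rfl⟩
  · exact ⟨((s i + s j, s k + s l), g), ⟨⟨Or.inr ⟨(i, j), rfl⟩, Or.inr ⟨(k, l), rfl⟩⟩, hg⟩, rfl⟩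

theorem exists_eq_Q_of_mem_Gamma {hd : 2 * ℓ + m = d}
    {s : Module.Basis (Fin p) K (Sec K n ℓ)} {h : Module.Basis (Fin q) K (Sec K n m)}
    {F : MvPolynomial (Idx n d) K} (hF : F ∈ Gamma hd s h) :
    ∃ a b g, LinearIndependent K ![a, b] ∧ g ≠ 0 ∧ F = Q hd a b g := by
  have coord_self (i : Fin p) : s.coord i (s i) = 1 := by simp
  have coord_of_ne {i j : Fin p} (hij : j ≠ i) : s.coord i (s j) = 0 := by simp [hij]
  rcases hF with (⟨i, j, hij, g, hg, rfl⟩ | ⟨i, j, k, ⟨hij, hki, -⟩, g, hg, rfl⟩) |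
    ⟨i, j, k, l, ⟨hij, hkl, hik, -, -⟩, g, hg, rfl⟩
  · exact ⟨s i, s j, g, linearIndependent_pair_of_dual (s.coord i) (s.coord j) (coord_self i)
      (coord_of_ne (ne_of_gt hij)) (coord_self j), ne_zero_of_mem_sumSet h hg, rfl⟩
  · refine ⟨s i + s j, s k, g, linearIndependent_pair_of_dual (s.coord i) (s.coord k) ?_
      (coord_of_ne hki) (coord_self k), ne_zero_of_mem_sumSet h hg, rfl⟩
    rw [map_add, coord_self, coord_of_ne (ne_of_gt hij), add_zero]
  · have hil : i < l := lt_trans hik hkl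
    refine ⟨s i + s j, s k + s l, g,
      linearIndependent_pair_of_dual (s.coord i) (s.coord k) ?_ ?_ ?_,
      ne_zero_of_mem_sumSet h hg, rfl⟩
    · rw [map_add, coord_self, coord_of_ne (ne_of_gt hij), add_zero]
    · rw [map_add, coord_of_ne (ne_of_gt hik), coord_of_ne (ne_of_gt hil), add_zero]
    · rw [map_add, coord_self, coord_of_ne (ne_of_gt hkl), add_zero]

end Generators

section Rank

variable {K : Type*} [Field K]

/-- The linear form `∑ v_i z_i` with coefficient vector `v`. -/
def linearForm {σ : Type*} [Fintype σ] (v : σ → K) : MvPolynomial σ K := ∑ i, C (v i) * X i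

theorem sum_sum_C_mul_mul {σ τ : Type*} [Fintype τ] (M : Matrix τ τ K)
    (Z : τ → MvPolynomial σ K) :
    ∑ i, ∑ j, C (M i j) * Z i * Z j = Z ⬝ᵥ (M.map C).mulVec Z := by
  simp only [dotProduct, Matrix.mulVec, Finset.mul_sum, Matrix.map_apply, mul_left_comm, mul_assoc]

theorem sum_sum_C_transpose_mul_mul {ι σ : Type*} [Fintype ι] [Fintype σ] (N : Matrix ι ι K)
    (P : Matrix ι σ K) :
    ∑ i, ∑ j, C ((P.transpose * (N * P)) i j) * X i * X j =
      ∑ a, ∑ b, C (N a b) * linearForm (P a) * linearForm (P b) := by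
  have linearForm_eq : (fun a => linearForm (P a)) = (P.map C).mulVec X := rfl
  rw [sum_sum_C_mul_mul, sum_sum_C_mul_mul N fun a => linearForm (P a), linearForm_eq,
    Matrix.map_mul, Matrix.map_mul, ← Matrix.mulVec_mulVec, ← Matrix.mulVec_mulVec,
    Matrix.dotProduct_mulVec, Matrix.transpose_map, Matrix.vecMul_transpose]

theorem isQuadricOfRank_of_linearIndependent {ι σ : Type*} [Fintype ι] [DecidableEq ι] [Fintype σ]
    {N : Matrix ι ι K} (hN : N.IsSymm) (hdet : IsUnit N.det) {v : ι → σ → K}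
    (hv : LinearIndependent K v) :
    IsQuadricOfRank (∑ a, ∑ b, C (N a b) * linearForm (v a) * linearForm (v b))
      (Fintype.card ι) := by
  let P : Matrix ι σ K := Matrix.of v
  refine ⟨P.transpose * (N * P), ?_, ?_, (sum_sum_C_transpose_mul_mul N P).symm⟩
  · rw [Matrix.IsSymm, Matrix.transpose_mul, Matrix.transpose_mul, hN, Matrix.transpose_transpose,
      Matrix.mul_assoc]
  · have injective_transpose : Function.Injective P.transpose.mulVecLin := by
      rw [Matrix.coe_mulVecLin, Matrix.mulVec_injective_iff]
      exact hv
    rw [Matrix.rank, Matrix.mulVecLin_mul, LinearMap.range_comp,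
      ← (Submodule.equivMapOfInjective _ injective_transpose _).finrank_eq, ← Matrix.rank,
      Matrix.rank_mul_eq_right_of_isUnit_det _ _ hdet]
    exact hv.rank_matrix

theorem isQuadricOfRank_three {σ : Type*} [Fintype σ] (h2 : (2 : K) ≠ 0) {u v w : σ → K}
    (hl : LinearIndependent K ![u, v, w]) :
    IsQuadricOfRank (linearForm u * linearForm w - linearForm v ^ 2) 3 := by
  let N : Matrix (Fin 3) (Fin 3) K := !![0, 0, 2⁻¹; 0, -1, 0; 2⁻¹, 0, 0]
  have hN : N.IsSymm := by
    ext i j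
    fin_cases i <;> fin_cases j <;> rfl
  have hdet : IsUnit N.det := by simp [N, Matrix.det_fin_three, h2]
  have half : (C 2⁻¹ : MvPolynomial σ K) * 2 = 1 := by
    rw [← map_ofNat C 2, ← C_mul, inv_mul_cancel₀ h2, C_1]
  have hrank := isQuadricOfRank_of_linearIndependent hN hdet hl
  rw [Fintype.card_fin] at hrank
  convert hrank using 1
  simp only [N, Fin.sum_univ_three, Matrix.of_apply, Matrix.cons_val, C_0, C_1, C_neg, zero_mul,
    zero_add, add_zero]
  linear_combination -linearForm u * linearForm w * half

theorem linearIndependent_sq_mul_sq {A : Type*} [CommRing A] [IsDomain A] [Algebra K A] {a b : A}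
    (hab : LinearIndependent K ![a, b]) (ev : A →ₐ[K] K) (hb : ev b ≠ 0) :
    LinearIndependent K ![a * a, a * b, b * b] := by
  rw [LinearIndependent.pair_iff] at hab
  rw [Fintype.linearIndependent_iff]
  intro c hc
  rw [Fin.sum_univ_three] at hc
  change c 0 • (a * a) + c 1 • (a * b) + c 2 • (b * b) = 0 at hc
  let r := ev a / ev b
  have hr : c 0 * r ^ 2 + c 1 * r + c 2 = 0 := by
    have := congrArg ev hc
    simp only [map_add, map_smul, map_mul, smul_eq_mul, map_zero] at this
    simp only [r]
    field_simp
    linear_combination this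
  have factorization : ((1 : K) • a + (-r) • b) * (c 0 • a + (c 1 + c 0 * r) • b) = 0 := by
    have hr' := congrArg (algebraMap K A) hr
    simp only [map_add, map_mul, map_pow, map_zero] at hr'
    simp only [Algebra.smul_def, map_add, map_mul, map_neg, map_one] at hc ⊢
    linear_combination hc - b * b * hr'
  have hleft : (1 : K) • a + (-r) • b ≠ 0 := fun h => one_ne_zero (hab _ _ h).1
  obtain ⟨h0, h1⟩ := hab _ _ ((mul_eq_zero.mp factorization).resolve_left hleft)
  rw [h0, zero_mul, add_zero] at h1
  rw [h0, h1, zero_mul, zero_mul, zero_add, zero_add] at hr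
  intro i
  fin_cases i
  exacts [h0, h1, hr]

variable {n d : ℕ}

/-- The coefficient vector `(c_I)_I` of a form `∑ c_I x^I` of degree `d`. -/
def coeffVector (K : Type*) [Field K] (n d : ℕ) : Sec K n d →ₗ[K] Idx n d → K :=
  LinearMap.pi fun I => lcoeff K I.1 ∘ₗ (Sec K n d).subtype

theorem phi_eq_linearForm (g : Sec K n d) : phi n d g = linearForm (coeffVector K n d g) := by
  rw [phi_eq_coordForm, coordForm_apply]
  rfl

theorem ker_coeffVector : LinearMap.ker (coeffVector K n d) = ⊥ := by
  refine LinearMap.ker_eq_bot'.mpr fun g hg => Subtype.ext (MvPolynomial.ext _ _ fun w => ?_)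
  by_cases hw : w.degree = d
  · exact congrFun hg ⟨w, w.degree_eq_sum.symm.trans hw⟩
  · exact IsHomogeneous.coeff_eq_zero g.2 hw

theorem linearIndependent_tripleProd [Infinite K] {ℓ m : ℕ} (hd : 2 * ℓ + m = d)
    {s t : Sec K n ℓ} {g : Sec K n m} (hst : LinearIndependent K ![s, t]) (hg : g ≠ 0) :
    LinearIndependent K ![tripleProd hd s s g, tripleProd hd s t g, tripleProd hd t t g] := by
  have coe_ne_zero {k : ℕ} {f : Sec K n k} (hf : f ≠ 0) : f.1 ≠ 0 := fun h => hf (Subtype.ext h)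
  obtain ⟨x, hx⟩ : ∃ x, eval x t.1 ≠ 0 := by
    by_contra! h
    have ht : t ≠ 0 := hst.ne_zero 1
    exact coe_ne_zero ht (MvPolynomial.funext fun x => by rw [h, map_zero])
  have hst' : LinearIndependent K ![s.1, t.1] := by
    rw [LinearIndependent.pair_iff] at hst ⊢
    exact fun x y hxy => hst x y (Subtype.ext hxy)
  have squares := linearIndependent_sq_mul_sq hst' (aeval x) hx
  have products := squares.map' (LinearMap.mulRight K g.1)
    (LinearMap.ker_eq_bot.mpr (mul_left_injective₀ (coe_ne_zero hg)))
  refine .of_comp (Sec K n d).subtype ?_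
  rw [← FinVec.map_eq] at products ⊢
  exact products

theorem isQuadricOfRank_three_Q [Infinite K] (h2 : (2 : K) ≠ 0) {ℓ m : ℕ} (hd : 2 * ℓ + m = d)
    {s t : Sec K n ℓ} {g : Sec K n m} (hst : LinearIndependent K ![s, t]) (hg : g ≠ 0) :
    IsQuadricOfRank (Q hd s t g) 3 := by
  rw [Q, phi_eq_linearForm, phi_eq_linearForm, phi_eq_linearForm]
  have hl := (linearIndependent_tripleProd hd hst hg).map' (coeffVector K n d) ker_coeffVector
  rw [← FinVec.map_eq] at hl
  exact isQuadricOfRank_three h2 hl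

end Rank

end Veronese

end

theorem theorem3p2_general {K : Type*} [Field K] [Infinite K] [CharP K 3] (n d : ℕ) (hd : 3 ≤ d)
    {p q : ℕ} (s : Module.Basis (Fin p) K (Veronese.Sec K n 1))
    (h : Module.Basis (Fin q) K (Veronese.Sec K n (d - 2))) :
    (Veronese.Gamma (show 2 * 1 + (d - 2) = d by omega) s h).Finite ∧
    (∀ F ∈ Veronese.Gamma (show 2 * 1 + (d - 2) = d by omega) s h,
      Veronese.IsQuadricOfRank F 3) ∧
    Ideal.span (Veronese.Gamma (show 2 * 1 + (d - 2) = d by omega) s h) =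
      Veronese.homogeneousIdeal (Veronese.veroneseVariety K n d) := by
  refine ⟨Veronese.finite_Gamma _ s h, fun F hF => ?_, le_antisymm ?_ ?_⟩
  · have two_ne_zero : (2 : K) ≠ 0 := Ring.two_ne_zero (by rw [ringChar.eq K 3]; decide)
    obtain ⟨a, b, g, hab, hg, rfl⟩ := Veronese.exists_eq_Q_of_mem_Gamma hF
    exact Veronese.isQuadricOfRank_three_Q two_ne_zero _ hab hg
  · refine Ideal.span_le.mpr fun F hF => ?_
    obtain ⟨a, b, g, -, -, rfl⟩ := Veronese.exists_eq_Q_of_mem_Gamma hF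
    exact Veronese.Q_mem_homogeneousIdeal _ a b g
  · exact Veronese.homogeneousIdeal_le_ker_pullback.trans <|
      Veronese.ker_pullback_le (by omega) fun _ _ _ _ =>
        Veronese.mk_X_mul_mk_X_eq_of_Gamma_subset hd Ideal.subset_span

theorem theorem3p2 {K : Type*} [Field K] [IsAlgClosed K] [CharP K 3] (n d : ℕ) (hn : 1 ≤ n)
    (hd : 3 ≤ d) {p q : ℕ} (s : Module.Basis (Fin p) K (Veronese.Sec K n 1))
    (h : Module.Basis (Fin q) K (Veronese.Sec K n (d - 2))) :
    (Veronese.Gamma (show 2 * 1 + (d - 2) = d by omega) s h).Finite ∧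
    (∀ F ∈ Veronese.Gamma (show 2 * 1 + (d - 2) = d by omega) s h,
      Veronese.IsQuadricOfRank F 3) ∧
    Ideal.span (Veronese.Gamma (show 2 * 1 + (d - 2) = d by omega) s h) =
      Veronese.homogeneousIdeal (Veronese.veroneseVariety K n d) :=
  have := IsAlgClosed.instInfinite (K := K)
  theorem3p2_general n d hd s h
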